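/- Let $R$ be an associative ring with identity that is semiprimary (its Jacobson radical $J(R)$ is nilpotent and $R/J(R)$ is semisimple artinian), right hereditary (submodules of projective right $R$-modules are projective) and left coherent (every finitely generated left ideal is finitely presented). Modules are unital right $R$-modules. A torsion theory is a pair $(\mathcal T,\mathcal F)$ of classes of modules such that $\operatorname{Hom}_R(M,N)=0$ for all $M\in\mathcal T$, $N\in\mathcal F$; every $A$ with $\operatorname{Hom}_R(A,N)=0$ for all $N\in\mathcal F$ lies in $\mathcal T$; and every $B$ with $\operatorname{Hom}_R(M,B)=0$ for all $M\in\mathcal T$ lies in $\mathcal F$. The torsion theory generated by a module $M$ is $(\mathcal T_M,\mathcal F_M)$ with $\mathcal F_M=\{N:\operatorname{Hom}_R(M,N)=0\}$ and $\mathcal T_M=\{A:\operatorname{Hom}_R(A,N)=0\text{ for all }N\in\mathcal F_M\}$. A module $M$ is $N$-subprojective if for every epimorphism $g:B\to N$ and every homomorphism $f:M\to N$ there is a homomorphism $h:M\to B$ with $gh=f$; and $M$ is sp-poor if the modules $N$ for which $M$ is $N$-subprojective are precisely the projective modules. Then the class $\mathfrak P$ of projective modules is the torsion-free class of a torsion theory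 $(\mathfrak T,\mathfrak P)$. Moreover, there exists an sp-poor $R$-module if and only if there exists a module $M$ such that $(\mathfrak T,\mathfrak P)$ is the torsion theory generated by $M$. -/

import Mathlib

open scoped MulOpposite

universe u

namespace SubProj

/-- The category of (unital) right `R`-modules, as modules over the opposite ring. -/
abbrev ModR (R : Type u) [Ring R] : Type (u + 1) := ModuleCat.{u} Rᵐᵒᵖ

/-- `R` is right hereditary: submodules of projective right modules are projective. -/
def IsRightHereditary (R : Type u) [Ring R] : Prop :=
  ∀ P : ModR R, Module.Projective Rᵐᵒᵖ P →
    ∀ N : Submodule Rᵐᵒᵖ P, Module.Projective Rᵐᵒᵖ N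

/-- `R` is left coherent: every finitely generated left ideal is finitely presented. -/
def IsLeftCoherent (R : Type u) [Ring R] : Prop :=
  ∀ I : Ideal R, I.FG → Module.FinitePresentation R I

/-- `M` is `N`-subprojective: maps `M → N` lift along every epimorphism onto `N`. -/
def IsSubprojective {R : Type u} [Ring R] (M N : ModR R) : Prop :=
  ∀ (B : ModR R) (g : B →ₗ[Rᵐᵒᵖ] N), Function.Surjective g →
    ∀ f : M →ₗ[Rᵐᵒᵖ] N, ∃ h : M →ₗ[Rᵐᵒᵖ] B, g ∘ₗ h = f

/-- The subprojectivity domain of `M`. -/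
def subprojectivityDomain {R : Type u} [Ring R] (M : ModR R) : Set (ModR R) :=
  {N | IsSubprojective M N}

/-- The class of all projective right `R`-modules. -/
def projectives (R : Type u) [Ring R] : Set (ModR R) :=
  {P | Module.Projective Rᵐᵒᵖ P}

/-- `M` is sp-poor: its subprojectivity domain consists precisely of the projective modules. -/
def IsSpPoor {R : Type u} [Ring R] (M : ModR R) : Prop :=
  subprojectivityDomain M = projectives R

/-- `Hom_R(M, N) = 0`. -/
def HomZero {R : Type u} [Ring R] (M N : ModR R) : Prop :=
  ∀ f : M →ₗ[Rᵐᵒᵖ] N, f = 0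

/-- A torsion theory on the category of right `R`-modules. -/
@[ext]
structure TorsionTheory (R : Type u) [Ring R] where
  /-- the torsion class -/
  torsion : Set (ModR R)
  /-- the torsion-free class -/
  torsionFree : Set (ModR R)
  homZero : ∀ M ∈ torsion, ∀ N ∈ torsionFree, HomZero M N
  mem_torsion : ∀ A : ModR R, (∀ N ∈ torsionFree, HomZero A N) → A ∈ torsion
  mem_torsionFree : ∀ B : ModR R, (∀ M ∈ torsion, HomZero M B) → B ∈ torsionFree

/-- The torsion theory generated by a class `C`: its torsion-free class consists of all `N` with
`Hom_R(X, N) = 0` for every `X` in `C`, and its torsion class of all `M` with `Hom_R(M, N) = 0`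
for every such `N`. -/
def TorsionTheory.generatedBy {R : Type u} [Ring R] (C : Set (ModR R)) : TorsionTheory R where
  torsion := {M | ∀ N : ModR R, (∀ X ∈ C, HomZero X N) → HomZero M N}
  torsionFree := {N | ∀ X ∈ C, HomZero X N}
  homZero := fun _ hM _ hN => hM _ hN
  mem_torsion := fun _ hA => hA
  mem_torsionFree := fun _ hB X hX => hB X fun _ hN => hN X hX

end SubProj

/-! Over a left coherent ring, powers of `R` are flat right modules (Chase); over a semiprimary
ring, flat modules are projective (Bass). With heredity, projectives are closed under products and
submodules, so each `B` has a least submodule `projRadical B` with projective quotient. That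
quotient splits off, so the radical has no nonzero map to a projective; this yields the torsion
theory. If `M` is sp-poor, its radical generates the theory: a map killing the radical factors
through a projective and hence lifts. Conversely, a generator `M` has no nonzero map to a free
module, so `M` is `N`-subprojective only when `Hom(M, N) = 0`. -/

/-! ### Flat implies projective modulo a nilpotent ideal -/

section ProjectiveOfFlat

variable {S : Type*} [Ring S] {J : Ideal S} {M F : Type*} [AddCommGroup M] [Module S M]
  [AddCommGroup F] [Module S F]

/-- The equational criterion for flatness: every linear relation in `M` is trivial. -/
def IsEquationallyFlat (S : Type*) [Ring S] (M : Type*) [AddCommGroup M] [Module S M] : Prop :=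
  ∀ (ι : Type) [Fintype ι] (j : ι → S) (m : ι → M), ∑ i, j i • m i = 0 →
    ∃ (κ : Type) (_ : Fintype κ) (s : κ → ι → S) (t : κ → M),
      (∀ l, ∑ i, j i * s l i = 0) ∧ ∀ i, m i = ∑ l, s l i • t l

theorem exists_sum_of_mem_ideal_smul_top {x : F} (hx : x ∈ J • (⊤ : Submodule S F)) :
    ∃ (ι : Type) (_ : Fintype ι) (j : ι → S) (p : ι → F),
      (∀ i, j i ∈ J) ∧ x = ∑ i, j i • p i := by
  induction hx using Submodule.smul_induction_on' with
  | smul r hr n _ => exact ⟨Unit, inferInstance, fun _ => r, fun _ => n, fun _ => hr, by simp⟩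
  | add x _ y _ hx hy =>
    obtain ⟨ι, _, j, p, hj, rfl⟩ := hx
    obtain ⟨κ, _, j', p', hj', rfl⟩ := hy
    refine ⟨ι ⊕ κ, inferInstance, Sum.elim j j', Sum.elim p p', ?_, by simp⟩
    rintro (i | i)
    exacts [hj i, hj' i]

theorem le_ideal_pow_smul_of_le_smul {K : Submodule S F} (h : K ≤ J • K) (n : ℕ) :
    K ≤ J ^ n • K := by
  induction n with
  | zero => simp [Submodule.pow_zero, Ideal.one_eq_top]
  | succ n ih =>
    rw [Submodule.pow_succ, Submodule.mul_smul]
    exact ih.trans (Submodule.smul_mono le_rfl h)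

/-- Nakayama's lemma; nilpotence of `J` replaces finite generation. -/
theorem eq_bot_of_le_nilpotent_smul (hJ : IsNilpotent J) {K : Submodule S F}
    (h : K ≤ J • K) : K = ⊥ := by
  obtain ⟨n, hn⟩ := hJ
  have := le_ideal_pow_smul_of_le_smul h n
  rw [hn] at this
  exact le_bot_iff.1 (this.trans (by simp))

theorem eq_top_of_sup_nilpotent_smul (hJ : IsNilpotent J) {N : Submodule S M}
    (h : N ⊔ J • ⊤ = ⊤) : N = ⊤ := by
  obtain ⟨n, hn⟩ := hJ
  have key : ∀ k : ℕ, N ⊔ J ^ k • ⊤ = ⊤ := by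
    intro k
    induction k with
    | zero => simp [Submodule.pow_zero, Ideal.one_eq_top]
    | succ k ih =>
      refine top_le_iff.1 (ih.ge.trans (sup_le le_sup_left ?_))
      calc J ^ k • (⊤ : Submodule S M) = J ^ k • N ⊔ J ^ (k + 1) • ⊤ := by
            rw [Submodule.pow_succ, Submodule.mul_smul, ← Submodule.smul_sup, h]
        _ ≤ _ := sup_le_sup_right Submodule.smul_le_right _
  simpa [hn] using key n

theorem ideal_smul_top_le_comap (f : F →ₗ[S] M) :
    J • (⊤ : Submodule S F) ≤ (J • (⊤ : Submodule S M)).comap f := by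
  rw [← Submodule.map_le_iff_le_comap, Submodule.map_smul'']
  exact Submodule.smul_mono le_rfl le_top

/-- The ring homomorphism from endomorphisms of `F` to endomorphisms of `F / JF`. -/
def endModIdeal (J : Ideal S) (F : Type*) [AddCommGroup F] [Module S F] :
    Module.End S F →+* Module.End S (F ⧸ J • (⊤ : Submodule S F)) where
  toFun f := Submodule.mapQ _ _ f (ideal_smul_top_le_comap f)
  map_one' := by ext; rfl
  map_mul' _ _ := by ext; rfl
  map_zero' := by ext; rfl
  map_add' _ _ := by ext; rfl

theorem endModIdeal_apply_mk (f : Module.End S F) (x : F) :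
    endModIdeal J F f (Submodule.Quotient.mk x) = Submodule.Quotient.mk (f x) := rfl

theorem endModIdeal_surjective [Module.Projective S F] :
    Function.Surjective (endModIdeal J F) := by
  intro g
  obtain ⟨f, hf⟩ := Module.projective_lifting_property (Submodule.mkQ (J • (⊤ : Submodule S F)))
    (g ∘ₗ Submodule.mkQ _) (Submodule.mkQ_surjective _)
  refine ⟨f, ?_⟩
  ext x
  exact LinearMap.congr_fun hf x

theorem isNilpotent_of_mem_ker_endModIdeal (hJ : IsNilpotent J) (f : Module.End S F)
    (hf : f ∈ RingHom.ker (endModIdeal J F)) : IsNilpotent f := by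
  have hfJ : LinearMap.range f ≤ J • ⊤ := by
    rintro _ ⟨x, rfl⟩
    rw [← Submodule.Quotient.mk_eq_zero, ← endModIdeal_apply_mk, (RingHom.mem_ker).1 hf]
    rfl
  have key : ∀ k : ℕ, LinearMap.range (f ^ k) ≤ J ^ k • ⊤ := by
    intro k
    induction k with
    | zero => simp [Submodule.pow_zero, Ideal.one_eq_top]
    | succ k ih =>
      rw [pow_succ', Module.End.mul_eq_comp, LinearMap.range_comp]
      refine (Submodule.map_mono ih).trans ?_
      rw [Submodule.map_smul'', Submodule.map_top, Submodule.pow_succ, Submodule.mul_smul]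
      exact Submodule.smul_mono le_rfl hfJ
  obtain ⟨n, hn⟩ := hJ
  refine ⟨n, LinearMap.range_eq_bot.1 (le_bot_iff.1 ((key n).trans ?_))⟩
  simp [hn]

theorem isSemisimpleModule_quotient_smul_top [J.IsTwoSided] [IsSemisimpleRing (S ⧸ J)] :
    IsSemisimpleModule S (F ⧸ J • (⊤ : Submodule S F)) := by
  let g : (F ⧸ J • (⊤ : Submodule S F)) →ₛₗ[Ideal.Quotient.mk J]
      (F ⧸ J • (⊤ : Submodule S F)) :=
    { toFun := id
      map_add' := fun _ _ => rfl
      map_smul' := fun _ _ => rfl }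
  have : RingHomSurjective (Ideal.Quotient.mk J) := ⟨Ideal.Quotient.mk_surjective⟩
  exact (g.isSemisimpleModule_iff_of_bijective Function.bijective_id).2 inferInstance

/-- Split `F / JF → M / JM` and lift the resulting idempotent to `e`. Then `π` maps the summand `eF`
onto `M`, and flatness makes the kernel vanish. -/
theorem IsEquationallyFlat.projective_of_surjective [J.IsTwoSided] [IsSemisimpleRing (S ⧸ J)]
    (hJ : IsNilpotent J) (hM : IsEquationallyFlat S M) [Module.Projective S F] (π : F →ₗ[S] M)
    (hπ : Function.Surjective π) : Module.Projective S M := by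
  let πq : (F ⧸ J • (⊤ : Submodule S F)) →ₗ[S] M ⧸ J • (⊤ : Submodule S M) :=
    Submodule.mapQ _ _ π (ideal_smul_top_le_comap π)
  have hπq : Function.Surjective πq := by
    intro y
    obtain ⟨y, rfl⟩ := Submodule.Quotient.mk_surjective _ y
    obtain ⟨x, rfl⟩ := hπ y
    exact ⟨Submodule.Quotient.mk x, rfl⟩
  have : IsSemisimpleModule S (F ⧸ J • (⊤ : Submodule S F)) :=
    isSemisimpleModule_quotient_smul_top
  obtain ⟨s, hs⟩ := IsSemisimpleModule.lifting_property πq hπq LinearMap.id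
  have hs' : ∀ y, πq (s y) = y := LinearMap.congr_fun hs
  have hidem : IsIdempotentElem (s ∘ₗ πq : Module.End S (F ⧸ J • (⊤ : Submodule S F))) := by
    ext x
    simp [hs']
  obtain ⟨e, he, hes⟩ := exists_isIdempotentElem_eq_of_ker_isNilpotent (endModIdeal J F)
    (isNilpotent_of_mem_ker_endModIdeal hJ) _ (endModIdeal_surjective _) hidem
  have hee : ∀ x, e (e x) = e x := LinearMap.congr_fun he
  have hes' : ∀ x : F, (Submodule.Quotient.mk (e x) : F ⧸ J • (⊤ : Submodule S F)) =
      s (Submodule.Quotient.mk (π x)) := fun x =>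
    LinearMap.congr_fun hes (Submodule.Quotient.mk x)
  have hsurj : LinearMap.range (π ∘ₗ e) = ⊤ := by
    refine eq_top_of_sup_nilpotent_smul hJ (top_le_iff.1 fun y _ => ?_)
    obtain ⟨x, rfl⟩ := hπ y
    have hx : π x - π (e x) ∈ J • (⊤ : Submodule S M) := by
      rw [← Submodule.Quotient.eq]
      have := congrArg πq (hes' x)
      rw [hs'] at this
      exact this.symm
    rw [← add_sub_cancel (π (e x)) (π x)]
    exact Submodule.add_mem_sup ⟨x, rfl⟩ hx
  have hlift : ∀ y : M, ∃ q : F, e q = q ∧ π q = y := by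
    intro y
    obtain ⟨x, hx⟩ := LinearMap.range_eq_top.1 hsurj y
    exact ⟨e x, hee x, hx⟩
  have hker : LinearMap.ker π ⊓ LinearMap.range e = ⊥ := by
    refine eq_bot_of_le_nilpotent_smul hJ ?_
    rintro k ⟨hkπ, x, rfl⟩
    have hmem : e x ∈ J • (⊤ : Submodule S F) := by
      rw [← Submodule.Quotient.mk_eq_zero, ← hee x, hes', LinearMap.mem_ker.1 hkπ]
      simp
    obtain ⟨ι, _, j, p, hj, hp⟩ := exists_sum_of_mem_ideal_smul_top hmem
    have hp' : e x = ∑ i, j i • e (p i) := by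
      rw [← hee x, hp]
      simp
    -- Trivialising this relation and lifting the `t l` to `eF` corrects each `e (p i)` to an
    -- element of the kernel `K`, so `K ≤ J • K`.
    obtain ⟨κ, _, a, t, ha, ht⟩ := hM ι j (fun i => π (e (p i))) (by
      rw [← LinearMap.mem_ker.1 hkπ, hp']
      simp)
    choose q hqe hqπ using fun l => hlift (t l)
    have hsum : e x = ∑ i, j i • (e (p i) - ∑ l, a l i • q l) := by
      have h0 : ∑ i, j i • ∑ l, a l i • q l = 0 := by
        simp_rw [Finset.smul_sum, smul_smul]
        rw [Finset.sum_comm]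
        simp_rw [← Finset.sum_smul, ha]
        simp
      simp_rw [smul_sub, Finset.sum_sub_distrib]
      rw [h0, sub_zero, hp']
    rw [hsum]
    refine Submodule.sum_mem _ fun i _ => Submodule.smul_mem_smul (hj i) ⟨?_, ?_⟩
    · simp [ht, hqπ]
    · exact ⟨p i - ∑ l, a l i • q l, by simp [hqe]⟩
  have : Module.Projective S (LinearMap.range e) :=
    Module.Projective.of_split (LinearMap.range e).subtype e.rangeRestrict (by
      ext ⟨_, x, rfl⟩
      simp [hee])
  refine Module.Projective.of_equiv
    (LinearEquiv.ofBijective (π ∘ₗ (LinearMap.range e).subtype) ⟨?_, ?_⟩)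
  · rw [← LinearMap.ker_eq_bot, LinearMap.ker_eq_bot']
    intro x hx
    have : (x : F) ∈ LinearMap.ker π ⊓ LinearMap.range e := ⟨hx, x.2⟩
    rw [hker] at this
    exact Subtype.ext this
  · intro y
    obtain ⟨q, hq, rfl⟩ := hlift y
    exact ⟨⟨q, q, hq⟩, rfl⟩

/-- A form of Bass' theorem: flat modules are projective when `J` is nilpotent and `S / J` is
semisimple. -/
theorem IsEquationallyFlat.projective [J.IsTwoSided] [IsSemisimpleRing (S ⧸ J)]
    (hJ : IsNilpotent J) (hM : IsEquationallyFlat S M) : Module.Projective S M :=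
  hM.projective_of_surjective hJ (Finsupp.linearCombination S (id : M → M))
    (Finsupp.linearCombination_id_surjective S M)

end ProjectiveOfFlat

/-! ### Powers of the ring as right modules -/

section Opposite

variable {R : Type u} [Ring R]

/-- The coordinates of a relation all lie in one syzygy module `ker f`, which coherence makes
finitely generated; its generators trivialise all coordinates at once. -/
theorem isEquationallyFlat_pi_mulOpposite (hcoh : SubProj.IsLeftCoherent R) (I : Type*) :
    IsEquationallyFlat Rᵐᵒᵖ (I → Rᵐᵒᵖ) := by
  intro ι _ j m hm
  let f : (ι → R) →ₗ[R] R := Fintype.linearCombination R fun i => (j i).unop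
  have hf : ∀ r, f r = ∑ i, r i * (j i).unop := fun r => Fintype.linearCombination_apply ..
  have : Module.FinitePresentation R (LinearMap.range f) :=
    hcoh _ (Module.Finite.iff_fg.1 inferInstance)
  have hfg := Module.FinitePresentation.fg_ker f.rangeRestrict f.surjective_rangeRestrict
  rw [LinearMap.ker_rangeRestrict] at hfg
  obtain ⟨n, g, hg⟩ := (LinearMap.ker f).fg_iff_exists_fin_linearMap.1 hfg
  have hrel : ∀ x, ∃ c, g c = fun i => (m i x).unop := by
    intro x
    rw [← LinearMap.mem_range, hg, LinearMap.mem_ker, hf]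
    have := congrArg MulOpposite.unop (congrFun hm x)
    simpa using this
  choose c hc using hrel
  refine ⟨Fin n, inferInstance, fun l i => MulOpposite.op (g (Pi.single l 1) i),
    fun l x => MulOpposite.op (c x l), fun l => ?_, fun i => ?_⟩
  · have : g (Pi.single l 1) ∈ LinearMap.ker f := hg ▸ ⟨_, rfl⟩
    rw [LinearMap.mem_ker, hf] at this
    apply MulOpposite.unop_injective
    simpa using this
  · ext x
    have h1 := congrFun (hc x) i
    rw [LinearMap.pi_apply_eq_sum_univ g (c x)] at h1
    apply MulOpposite.unop_injective
    rw [← h1]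
    simp only [Finset.sum_apply, Pi.smul_apply, smul_eq_mul, Finset.unop_sum,
      MulOpposite.unop_mul, MulOpposite.unop_op]
    refine Finset.sum_congr rfl fun l _ => ?_
    have hl : (Pi.single l 1 : Fin n → R) = fun l' => if l = l' then 1 else 0 := by
      ext l'
      simp [Pi.single_apply, eq_comm]
    rw [hl]

/-- The Jacobson radical of `R` as an ideal of the opposite ring. -/
def opJacobson (R : Type u) [Ring R] : Ideal Rᵐᵒᵖ :=
  RingHom.ker (RingHom.op (Ideal.Quotient.mk (Ring.jacobson R)))

instance : (opJacobson R).IsTwoSided := by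
  unfold opJacobson
  infer_instance

theorem mem_opJacobson {x : Rᵐᵒᵖ} : x ∈ opJacobson R ↔ x.unop ∈ Ring.jacobson R := by
  rw [opJacobson, RingHom.mem_ker, RingHom.op_apply_apply, MulOpposite.op_eq_zero_iff]
  exact Ideal.Quotient.eq_zero_iff_mem

theorem isSemisimpleRing_quotient_opJacobson [IsSemiprimaryRing R] :
    IsSemisimpleRing (Rᵐᵒᵖ ⧸ opJacobson R) := by
  refine (RingHom.quotientKerEquivOfSurjective
    (f := RingHom.op (Ideal.Quotient.mk (Ring.jacobson R))) fun y => ?_).symm.isSemisimpleRing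
  obtain ⟨x, hx⟩ := Ideal.Quotient.mk_surjective y.unop
  exact ⟨MulOpposite.op x, MulOpposite.unop_injective hx⟩

theorem isNilpotent_opJacobson [IsSemiprimaryRing R] : IsNilpotent (opJacobson R) := by
  have key : ∀ (k : ℕ) (x : Rᵐᵒᵖ), x ∈ opJacobson R ^ k → x.unop ∈ Ring.jacobson R ^ k := by
    intro k
    induction k with
    | zero => simp [Submodule.pow_zero, Ideal.one_eq_top]
    | succ k ih =>
      intro x hx
      rw [Submodule.pow_succ] at hx
      induction hx using Submodule.mul_induction_on' with
      | mem_mul_mem a ha b hb =>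
        -- `unop` reverses products, so the extra factor must be split off on the left.
        rw [Ideal.IsTwoSided.pow_succ]
        exact Ideal.mul_mem_mul (mem_opJacobson.1 hb) (ih a ha)
      | add a _ b _ ha hb => exact Ideal.add_mem _ ha hb
  obtain ⟨n, hn⟩ := IsSemiprimaryRing.isNilpotent (R := R)
  refine ⟨n, le_bot_iff.1 fun x hx => ?_⟩
  have := key n x hx
  rw [hn] at this
  exact MulOpposite.unop_injective this

theorem projective_pi_mulOpposite [IsSemiprimaryRing R] (hcoh : SubProj.IsLeftCoherent R)
    (I : Type*) : Module.Projective Rᵐᵒᵖ (I → Rᵐᵒᵖ) :=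
  have := isSemisimpleRing_quotient_opJacobson (R := R)
  (isEquationallyFlat_pi_mulOpposite hcoh I).projective isNilpotent_opJacobson

end Opposite

/-! ### The projective radical and torsion theories -/

namespace SubProj

variable {R : Type u} [Ring R]

section Radical

variable (hher : IsRightHereditary R)

include hher

theorem IsRightHereditary.projective_of_injective {N P : Type u} [AddCommGroup N] [Module Rᵐᵒᵖ N]
    [AddCommGroup P] [Module Rᵐᵒᵖ P] [hP : Module.Projective Rᵐᵒᵖ P] (f : N →ₗ[Rᵐᵒᵖ] P)
    (hf : Function.Injective f) : Module.Projective Rᵐᵒᵖ N :=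
  have : Module.Projective Rᵐᵒᵖ (LinearMap.range f) :=
    hher (ModuleCat.of Rᵐᵒᵖ P) hP (LinearMap.range f)
  .of_equiv (LinearEquiv.ofInjective f hf).symm

theorem IsRightHereditary.projective_quotient_ker {N P : Type u} [AddCommGroup N]
    [Module Rᵐᵒᵖ N] [AddCommGroup P] [Module Rᵐᵒᵖ P] [Module.Projective Rᵐᵒᵖ P]
    (f : N →ₗ[Rᵐᵒᵖ] P) : Module.Projective Rᵐᵒᵖ (N ⧸ LinearMap.ker f) :=
  hher.projective_of_injective ((LinearMap.ker f).liftQ f le_rfl)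
    (LinearMap.ker_eq_bot.1 (Submodule.ker_liftQ_eq_bot _ _ _ le_rfl))

/-- Each `P i` embeds in a power of `R` through the coordinates of a section from `P i` to a free
module, so the product does too. -/
theorem IsRightHereditary.projective_pi [IsSemiprimaryRing R] (hcoh : IsLeftCoherent R)
    {ι : Type u} (P : ι → Type u) [∀ i, AddCommGroup (P i)] [∀ i, Module Rᵐᵒᵖ (P i)]
    [∀ i, Module.Projective Rᵐᵒᵖ (P i)] : Module.Projective Rᵐᵒᵖ (∀ i, P i) := by
  have := projective_pi_mulOpposite hcoh (Σ i, P i)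
  choose s hs using fun i => Module.projective_def'.1 (inferInstance : Module.Projective Rᵐᵒᵖ (P i))
  refine hher.projective_of_injective
    (LinearMap.pi fun j : Σ i, P i => Finsupp.lapply j.2 ∘ₗ s j.1 ∘ₗ LinearMap.proj j.1 :
      (∀ i, P i) →ₗ[Rᵐᵒᵖ] ((Σ i, P i) → Rᵐᵒᵖ)) fun x y hxy => ?_
  ext i
  have hsi : s i (x i) = s i (y i) := by
    ext p
    exact congrFun hxy ⟨i, p⟩
  have hx := LinearMap.congr_fun (hs i) (x i)
  rw [LinearMap.comp_apply, hsi] at hx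
  exact hx.symm.trans (LinearMap.congr_fun (hs i) (y i))

end Radical

/-- The smallest submodule with projective quotient. -/
def projRadical (B : Type u) [AddCommGroup B] [Module Rᵐᵒᵖ B] : Submodule Rᵐᵒᵖ B :=
  sInf {K | Module.Projective Rᵐᵒᵖ (B ⧸ K)}

variable [IsSemiprimaryRing R] (hher : IsRightHereditary R) (hcoh : IsLeftCoherent R)
  (B : Type u) [AddCommGroup B] [Module Rᵐᵒᵖ B]

include hher hcoh

theorem projective_quotient_projRadical :
    Module.Projective Rᵐᵒᵖ (B ⧸ projRadical (R := R) B) := by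
  let ι := {K : Submodule Rᵐᵒᵖ B // Module.Projective Rᵐᵒᵖ (B ⧸ K)}
  have : ∀ K : ι, Module.Projective Rᵐᵒᵖ (B ⧸ K.1) := fun K => K.2
  have := hher.projective_pi hcoh (fun K : ι => B ⧸ K.1)
  have hker : LinearMap.ker (LinearMap.pi fun K : ι => K.1.mkQ) = projRadical (R := R) B := by
    rw [LinearMap.ker_pi, projRadical, sInf_eq_iInf']
    simp only [Submodule.ker_mkQ]
    rfl
  rw [← hker]
  exact hher.projective_quotient_ker _

theorem eq_zero_of_projRadical_to_projective {P : Type u} [AddCommGroup P] [Module Rᵐᵒᵖ P]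
    [Module.Projective Rᵐᵒᵖ P] (f : projRadical (R := R) B →ₗ[Rᵐᵒᵖ] P) : f = 0 := by
  have := projective_quotient_projRadical hher hcoh B
  obtain ⟨s, hs⟩ := Module.projective_lifting_property (projRadical (R := R) B).mkQ LinearMap.id
    (Submodule.mkQ_surjective _)
  let c : B →ₗ[Rᵐᵒᵖ] projRadical (R := R) B :=
    LinearMap.codRestrict _ (LinearMap.id - s ∘ₗ Submodule.mkQ _) fun b => by
      rw [← Submodule.Quotient.mk_eq_zero]
      have h := LinearMap.congr_fun hs (Submodule.mkQ _ b)
      simpa [sub_eq_zero] using h.symm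
  -- The retraction `c` extends `f` to `B`. As `φ` has projective target, minimality of the radical
  -- puts it inside `ker φ`, where `f ∘ₗ c` vanishes.
  let φ : B →ₗ[Rᵐᵒᵖ] P × (B ⧸ projRadical (R := R) B) := (f ∘ₗ c).prod (Submodule.mkQ _)
  have hle : projRadical (R := R) B ≤ LinearMap.ker φ :=
    sInf_le (hher.projective_quotient_ker φ)
  ext x
  have hc : c x = x := by
    ext
    simp [c, (Submodule.Quotient.mk_eq_zero _).2 x.2]
  have := congrArg Prod.fst (LinearMap.mem_ker.1 (hle x.2))
  simpa [φ, hc] using this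

/-- The torsion theory whose torsion-free modules are the projective modules. -/
def projectiveTorsionTheory : TorsionTheory R where
  torsion := {A | ∀ N ∈ projectives R, HomZero A N}
  torsionFree := projectives R
  homZero _ hM := hM
  mem_torsion _ hA := hA
  mem_torsionFree B hB := by
    have hsub := hB (ModuleCat.of Rᵐᵒᵖ (projRadical (R := R) B)) (fun N hN f =>
      have : Module.Projective Rᵐᵒᵖ N := hN
      eq_zero_of_projRadical_to_projective hher hcoh B f) (projRadical (R := R) B).subtype
    have hbot : projRadical (R := R) B = ⊥ := by
      rw [← Submodule.range_subtype (projRadical (R := R) B), LinearMap.range_eq_bot]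
      exact hsub
    have := projective_quotient_projRadical hher hcoh B
    exact .of_equiv (Submodule.quotEquivOfEqBot _ hbot)

theorem homZero_projRadical_iff {M : ModR R} (hM : IsSpPoor M) (N : ModR R) :
    HomZero (ModuleCat.of Rᵐᵒᵖ (projRadical (R := R) M)) N ↔ N ∈ projectives R := by
  refine ⟨fun h => ?_, fun (hN : Module.Projective Rᵐᵒᵖ N) f =>
    eq_zero_of_projRadical_to_projective hher hcoh M f⟩
  rw [← hM]
  intro B g hg f
  have := projective_quotient_projRadical hher hcoh M
  have hf : projRadical (R := R) M ≤ LinearMap.ker f := fun x hx =>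
    LinearMap.congr_fun (h (f ∘ₗ (projRadical (R := R) M).subtype)) ⟨x, hx⟩
  obtain ⟨t, ht⟩ := Module.projective_lifting_property g ((projRadical (R := R) M).liftQ f hf) hg
  refine ⟨t ∘ₗ Submodule.mkQ _, ?_⟩
  rw [← LinearMap.comp_assoc, ht, Submodule.liftQ_mkQ]

omit [IsSemiprimaryRing R] hher hcoh

theorem isSubprojective_iff_homZero {M : ModR R} (hM : ∀ N ∈ projectives R, HomZero M N)
    (N : ModR R) : IsSubprojective M N ↔ HomZero M N := by
  refine ⟨fun h f => ?_, fun h B g _ f => ⟨0, by rw [h f, LinearMap.comp_zero]⟩⟩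
  obtain ⟨t, ht⟩ := h (ModuleCat.of Rᵐᵒᵖ (N →₀ Rᵐᵒᵖ)) (Finsupp.linearCombination Rᵐᵒᵖ id)
    (Finsupp.linearCombination_id_surjective Rᵐᵒᵖ N) f
  rw [← ht, hM _ (inferInstanceAs (Module.Projective Rᵐᵒᵖ (N →₀ Rᵐᵒᵖ))) t, LinearMap.comp_zero]

theorem TorsionTheory.eq_of_torsionFree_eq {σ τ : TorsionTheory R}
    (h : σ.torsionFree = τ.torsionFree) : σ = τ :=
  TorsionTheory.ext (Set.ext fun A =>
    ⟨fun hA => τ.mem_torsion A fun N hN => σ.homZero A hA N (h ▸ hN),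
      fun hA => σ.mem_torsion A fun N hN => τ.homZero A hA N (h ▸ hN)⟩) h

end SubProj

theorem mainTheorem10 (R : Type u) [Ring R] (hsemi : IsSemiprimaryRing R)
    (hher : SubProj.IsRightHereditary R) (hcoh : SubProj.IsLeftCoherent R) :
    (∃ τ : SubProj.TorsionTheory R, τ.torsionFree = SubProj.projectives R) ∧
    ∀ τ : SubProj.TorsionTheory R, τ.torsionFree = SubProj.projectives R →
      ((∃ M : SubProj.ModR R, SubProj.IsSpPoor M) ↔
        ∃ M : SubProj.ModR R, SubProj.TorsionTheory.generatedBy {M} = τ) := by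
  refine ⟨⟨SubProj.projectiveTorsionTheory hher hcoh, rfl⟩, fun τ hτ => ⟨?_, ?_⟩⟩
  · rintro ⟨M, hM⟩
    refine ⟨ModuleCat.of Rᵐᵒᵖ (SubProj.projRadical (R := R) M),
      SubProj.TorsionTheory.eq_of_torsionFree_eq ?_⟩
    rw [hτ]
    ext N
    rw [← SubProj.homZero_projRadical_iff hher hcoh hM N]
    simp [SubProj.TorsionTheory.generatedBy]
  · rintro ⟨M, rfl⟩
    have key : ∀ N, N ∈ SubProj.projectives R ↔ SubProj.HomZero M N := fun N => by
      rw [← hτ]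
      simp [SubProj.TorsionTheory.generatedBy]
    refine ⟨M, Set.ext fun N => ?_⟩
    rw [key N]
    exact SubProj.isSubprojective_iff_homZero (fun N hN => (key N).1 hN) N
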